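/- Let $G(K)=\#(K\cap\mathbb{Z}^n)$ for bounded $K\subset\mathbb{R}^n$. A set $Z\subset\mathbb{R}^n$ is an $n$-dimensional lattice parallelepiped if $Z=p+\{\sum_{j=1}^n\alpha_j v_j : 0\le\alpha_j\le 1\}$ with $p,v_1,\dots,v_n\in\mathbb{Z}^n$ and $v_1,\dots,v_n$ linearly independent. Put $DZ=Z-Z$ and, for $1\le i\le n$, let $$\lambda_i(DZ)=\min\{\lambda>0 : \dim(\lambda\, DZ\cap\mathbb{Z}^n)\ge i\}$$ be its successive minima, where $\dim$ is the dimension of the affine hull. Let $\sigma_i(x_1,\dots,x_n)=\sum_{I\subseteq\{1,\dots,n\},\,\#I=i}\ \prod_{j\in I}x_j$ be the $i$-th elementary symmetric function ($\sigma_0=1$). Then for every $n$-dimensional lattice parallelepiped $Z\subset\mathbb{R}^n$ there are unique real numbers $g_0(Z),\dots,g_n(Z)$ (the Ehrhart coefficients of $Z$) with $G(kZ)=\sum_{i=0}^n g_i(Z)k^i$ for all integers $k\ge 0$, and $$g_i(Z)\le\sigma_i\Big(\frac1{\lambda_1(DZ)},\dots,\frac1{\lambda_n(DZ)}\Big),\qquad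 i=0,\dots,n.$$ In particular, $$G(Z)\le\prod_{i=1}^n\Big(\frac1{\lambda_i(DZ)}+1\Big).$$ All these inequalities are best possible: the unit cube $[0,1]^n$ is a lattice parallelepiped for which equality holds for every $i=0,\dots,n$ and also in the bound for $G$. -/

import Mathlib

open scoped Pointwise

namespace EhrhartMinima

variable {n : ℕ}

/-- The integer lattice `ℤⁿ` as a subset of `ℝⁿ`. -/
def integerLattice (n : ℕ) : Set (Fin n → ℝ) :=
  Set.range fun (z : Fin n → ℤ) (j : Fin n) => (z j : ℝ)

/-- The lattice point enumerator `G(K) = #(K ∩ ℤⁿ)` (for bounded `K`). -/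
noncomputable def latticePoints (K : Set (Fin n → ℝ)) : ℕ :=
  (K ∩ integerLattice n).ncard

/-- The dimension of the affine hull of a set. -/
noncomputable def affineDim (S : Set (Fin n → ℝ)) : ℕ :=
  Module.finrank ℝ (vectorSpan ℝ S)

/-- The successive minimum `λ_i(K) = min {t > 0 : dim (tK ∩ ℤⁿ) ≥ i}`, for `1 ≤ i ≤ n`. -/
noncomputable def successiveMinimum (K : Set (Fin n → ℝ)) (i : ℕ) : ℝ :=
  sInf {t : ℝ | 0 < t ∧ i ≤ affineDim (t • K ∩ integerLattice n)}

/-- `g = (g_0, …, g_n)` satisfies `G(kP) = ∑_{i=0}^n g_i kⁱ` for all natural numbers `k`. -/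
def IsEhrhartCoeffs (P : Set (Fin n → ℝ)) (g : Fin (n + 1) → ℝ) : Prop :=
  ∀ k : ℕ, (latticePoints ((k : ℝ) • P) : ℝ) = ∑ i, g i * (k : ℝ) ^ (i : ℕ)

/-- There is at most one tuple of Ehrhart coefficients. -/
theorem IsEhrhartCoeffs.unique {P : Set (Fin n → ℝ)} {g h : Fin (n + 1) → ℝ}
    (hg : IsEhrhartCoeffs P g) (hh : IsEhrhartCoeffs P h) : g = h := by
  have hinj : Function.Injective (fun k : Fin (n + 1) => ((k : ℕ) : ℝ)) := by
    intro a b hab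
    exact Fin.ext (by simpa using hab)
  have key : g - h = 0 := by
    refine Matrix.eq_zero_of_forall_index_sum_mul_pow_eq_zero hinj ?_
    intro k
    have h1 := (hg k).symm.trans (hh k)
    have h2 : ∑ i, (g i - h i) * ((k : ℕ) : ℝ) ^ (i : ℕ) = 0 := by
      simp only [sub_mul, Finset.sum_sub_distrib, h1, sub_self]
    simpa using h2
  exact sub_eq_zero.mp key

/-- The Ehrhart coefficients `g_0(P), …, g_n(P)`: the unique tuple satisfying `IsEhrhartCoeffs`
when there is one. -/
noncomputable def ehrhartCoeff (P : Set (Fin n → ℝ)) : Fin (n + 1) → ℝ :=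
  Classical.epsilon (IsEhrhartCoeffs P)

/-- The elementary symmetric function `σ_i(x_1, …, x_n)`. -/
def sigma (i : ℕ) (x : Fin n → ℝ) : ℝ :=
  ∑ I ∈ Finset.powersetCard i (Finset.univ : Finset (Fin n)), ∏ j ∈ I, x j

/-- The vector `(1/λ_1(DP), …, 1/λ_n(DP))`, where `DP = P - P`. -/
noncomputable def invMinima (P : Set (Fin n → ℝ)) (j : Fin n) : ℝ :=
  1 / successiveMinimum (P - P) ((j : ℕ) + 1)

/-- `Z` is an `n`-dimensional lattice parallelepiped in `ℝⁿ`: a lattice translate of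
`{∑ α_j v_j : 0 ≤ α_j ≤ 1}` for linearly independent `v_1, …, v_n ∈ ℤⁿ`. -/
def IsLatticeParallelepiped (Z : Set (Fin n → ℝ)) : Prop :=
  ∃ (p : Fin n → ℝ) (v : Fin n → Fin n → ℝ),
    p ∈ integerLattice n ∧ (∀ j, v j ∈ integerLattice n) ∧
      LinearIndependent ℝ v ∧ Z = p +ᵥ parallelepiped v

end EhrhartMinima

/-! In the coordinates given by the edges `v`, the parallelepiped becomes a translate of the unit
cube, `DZ` becomes the sup-norm unit ball, and `ℤⁿ` becomes a lattice `L` with `ℤⁿ ⊆ L ⊆ (1/D)ℤⁿ`.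
The successive minima of `DZ` are then the sup-norm minima `‖w i‖` of `L`.

Counting: a point of `L ∩ [0,k]ⁿ` splits into a fractional part `β ∈ L ∩ [0,1)ⁿ` and an integer
part, and `β` admits `∏ (k + [β_i = 0])` integer parts. Expanding the product shows that `g_i` is
the sum over `#J = i` of the number of `β` supported in `J` (`ncard_box`).

Bounding one term: Minkowski's second theorem for the section of `L` by `ℝ^J` bounds this number by
the inverse product of the minima of the section (`ncard_unitPoints_mul_prod_le`, from
`exists_squeezed_cube` and a packing argument). Using the minima of the section directly would not
give distinct products of the `1/‖w i‖`. Pivot coordinates for the flag spanned by the `w i` supply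
a permutation `c` such that the section over `J = c(K)` has minima at least the `‖w i‖`, `i ∈ K`, in
order (`norm_le_of_coordSection`). As `K` runs over the `i`-subsets, so does `J`, and the bounds add
up to `σ_i`. The bound on `G(Z)` is the sum of these at `k = 1`. -/

namespace EhrhartMinima
open MeasureTheory

/-! ### Measurable triangular maps and Minkowski's squeezed cube -/

/-- A map of the form `y ↦ (y i + h i y)ᵢ`, where `h i` only depends on the coordinates after `i`,
preserves Lebesgue measure. -/
theorem measurePreserving_unitriangular {m : ℕ} (h : Fin m → (Fin m → ℝ) → ℝ)
    (hm : ∀ i, Measurable (h i))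
    (hd : ∀ i y y', (∀ j, i < j → y j = y' j) → h i y = h i y') :
    MeasurePreserving (fun (y : Fin m → ℝ) i => y i + h i y) volume volume := by
  induction m with
  | zero =>
    convert MeasurePreserving.id (volume : Measure (Fin 0 → ℝ)) using 1
  | succ m ih =>
    -- Coordinate 0 influences no other coordinate, so the map descends to the tail, the inserted
    -- `0` being a dummy value. Over each tail it acts on coordinate 0 as a translation, and the
    -- skew product theorem applies.
    have htail : MeasurePreserving
        (fun (t : Fin m → ℝ) i => t i + h i.succ (Fin.cons 0 t)) volume volume := by
      refine ih (fun i t => h i.succ (Fin.cons 0 t)) (fun i => (hm _).comp ?_) ?_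
      · refine measurable_pi_lambda _ fun j => ?_
        refine Fin.cases ?_ (fun j => ?_) j
        · simp
        · simpa using measurable_pi_apply j
      · intro i y y' hy
        refine hd _ _ _ fun j => ?_
        refine Fin.cases (by simp) (fun j hj => ?_) j
        simpa using hy j (Fin.succ_lt_succ_iff.1 hj)
    have hskew : MeasurePreserving
        (fun p : (Fin m → ℝ) × ℝ => ((fun i => p.1 i + h i.succ (Fin.cons 0 p.1)),
          p.2 + h 0 (Fin.cons 0 p.1))) (volume.prod volume) (volume.prod volume) := by
      refine htail.skew_product (g := fun t a => a + h 0 (Fin.cons 0 t)) ?_ ?_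
      · refine measurable_snd.add ((hm 0).comp ?_)
        refine measurable_pi_lambda _ fun j => ?_
        refine Fin.cases ?_ (fun j => ?_) j
        · simp
        · exact (measurable_pi_apply j).comp measurable_fst
      · exact Filter.Eventually.of_forall fun t =>
          (measurePreserving_add_right volume (h 0 (Fin.cons 0 t))).map_eq
    have he := volume_preserving_piFinSuccAbove (fun _ : Fin (m + 1) => ℝ) 0
    have hcomp := (he.symm _).comp
      ((Measure.measurePreserving_swap (μ := (volume : Measure (Fin m → ℝ)))
        (ν := (volume : Measure ℝ))).comp
        (hskew.comp ((Measure.measurePreserving_swap (μ := (volume : Measure ℝ))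
          (ν := (volume : Measure (Fin m → ℝ)))).comp he)))
    have h0 : ∀ i (y : Fin (m + 1) → ℝ),
        h i y = h i (Fin.cons 0 (Fin.tail y) : Fin (m + 1) → ℝ) := fun i y => by
      refine hd _ _ _ fun j => ?_
      refine Fin.cases (fun hj => absurd hj (Fin.not_lt_zero _)) (fun j _ => ?_) j
      simp [Fin.tail]
    have heq : (fun (y : Fin (m + 1) → ℝ) i => y i + h i y) =
        (MeasurableEquiv.piFinSuccAbove (fun _ : Fin (m + 1) => ℝ) 0).symm ∘ Prod.swap ∘
          (fun p : (Fin m → ℝ) × ℝ => ((fun i => p.1 i + h i.succ (Fin.cons 0 p.1)),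
            p.2 + h 0 (Fin.cons 0 p.1))) ∘ Prod.swap ∘
          MeasurableEquiv.piFinSuccAbove (fun _ : Fin (m + 1) => ℝ) 0 := by
      funext y i
      refine Fin.cases ?_ (fun i => ?_) i
      · rw [h0]
        rfl
      · rw [h0]
        rfl
    rw [heq]
    exact hcomp

/-- Replace the first `k` coordinates of `y` by those of `q`. -/
def mix {m : ℕ} (k : ℕ) (q y : Fin m → ℝ) : Fin m → ℝ := fun i => if (i : ℕ) < k then q i else y i

theorem mix_congr {m k : ℕ} {q y y' : Fin m → ℝ} (h : ∀ j : Fin m, k ≤ j → y j = y' j) :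
    mix k q y = mix k q y' := by
  ext i
  unfold mix
  split_ifs with hi
  · rfl
  · exact h i (not_lt.1 hi)

theorem continuous_mix_left {m : ℕ} (k : ℕ) (y : Fin m → ℝ) : Continuous fun q => mix k q y := by
  refine continuous_pi fun i => ?_
  unfold mix
  split_ifs <;> fun_prop

theorem continuous_mix_right {m : ℕ} (k : ℕ) (q : Fin m → ℝ) : Continuous fun y => mix k q y := by
  refine continuous_pi fun i => ?_
  unfold mix
  split_ifs <;> fun_prop

theorem mix_self {m : ℕ} (k : ℕ) (y : Fin m → ℝ) : mix k y y = y := by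
  ext i
  simp [mix]

/-- Measurable choice of a point in the fibre of an open set over the coordinates from `k` on. -/
theorem exists_measurable_selection {m : ℕ} {C : Set (Fin m → ℝ)} (hC : IsOpen C) (k : ℕ) :
    ∃ f : (Fin m → ℝ) → Fin m → ℝ, Measurable f ∧
      (∀ y y', (∀ j : Fin m, k ≤ j → y j = y' j) → f y = f y') ∧
      ∀ y ∈ C, mix k (f y) y ∈ C := by
  classical
  let q := TopologicalSpace.denseSeq (Fin m → ℝ)
  -- The first index that works is chosen. The second alternative lets the search stop when no index
  -- works. Since `p y` sees only the coordinates from `k` on, so does the choice.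
  let p : (Fin m → ℝ) → ℕ → Prop := fun y N =>
    mix k (q N) y ∈ C ∨ ∀ N', mix k (q N') y ∉ C
  have hp : ∀ y, ∃ N, p y N := fun y => by
    by_cases h : ∃ N, mix k (q N) y ∈ C
    · exact ⟨h.choose, Or.inl h.choose_spec⟩
    · exact ⟨0, Or.inr (not_exists.1 h)⟩
  have hmeas : ∀ N, MeasurableSet {y | mix k (q N) y ∈ C} := fun N =>
    (hC.preimage (continuous_mix_right k (q N))).measurableSet
  refine ⟨fun y => q (Nat.find (hp y)), ?_, ?_, ?_⟩
  · refine (measurable_from_nat (f := q)).comp (measurable_find hp fun N => ?_)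
    refine (hmeas N).union ?_
    have : {y | ∀ N', mix k (q N') y ∉ C} = ⋂ N', {y | mix k (q N') y ∈ C}ᶜ := by
      ext; simp
    change MeasurableSet {y | ∀ N', mix k (q N') y ∉ C}
    rw [this]
    exact MeasurableSet.iInter fun N' => (hmeas N').compl
  · intro y y' h
    have : p y = p y' := by
      funext N
      simp only [p, mix_congr h]
    simp only [this]
  · intro y hy
    have hop : IsOpen {z | mix k z y ∈ C} := hC.preimage (continuous_mix_left k y)
    obtain ⟨_, hz, N, rfl⟩ := (TopologicalSpace.denseRange_denseSeq (Fin m → ℝ)).inter_open_nonempty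
      _ hop ⟨y, by simpa [mix_self] using hy⟩
    rcases Nat.find_spec (hp y) with h | h
    · exact h
    · exact absurd hz (h N)

/-- **Minkowski's squeezed cube**: a set of volume `∏ r i` whose nonzero differences `d` satisfy
`‖d‖ < r k` and `d ∉ span (b j, j < k)` for some `k`. -/
theorem exists_squeezed_cube {ι : Type*} [Fintype ι] {m : ℕ} (b : Module.Basis (Fin m) ℝ (ι → ℝ))
    (r : ℕ → ℝ) (hr : Monotone r) (hr0 : 0 < r 0) :
    ∃ P : Set (ι → ℝ), MeasurableSet P ∧ volume P = ENNReal.ofReal (∏ i : Fin m, r i) ∧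
      ∀ x ∈ P, ∀ y ∈ P, x ≠ y → ∃ k : Fin m, ‖x - y‖ < r k ∧
        x - y ∉ Submodule.span ℝ (b '' {j | j < k}) := by
  classical
  have hrpos : ∀ i, 0 < r i := fun i => hr0.trans_le (hr (Nat.zero_le i))
  let B : (Fin m → ℝ) ≃L[ℝ] (ι → ℝ) := b.equivFun.symm.toContinuousLinearEquiv
  let C : Set (ι → ℝ) := Set.univ.pi fun _ => Set.Ioo 0 1
  have hC : IsOpen C := isOpen_set_pi Set.finite_univ fun _ _ => isOpen_Ioo
  have hC' : IsOpen (B ⁻¹' C) := hC.preimage B.continuous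
  choose f hfm hfd hfC using fun k => exists_measurable_selection hC' k
  let s : ℕ → (Fin m → ℝ) → Fin m → ℝ := fun k y => mix k (f k y) y
  have hs_le : ∀ (k : ℕ) y (i : Fin m), k ≤ i → s k y i = y i := fun k y i h => by
    simp [s, mix, not_lt.2 h]
  have hs_gt : ∀ k y (i : Fin m), (i : ℕ) < k → s k y i = f k y i := fun k y i h => by
    simp [s, mix, h]
  have hs_congr : ∀ (k : ℕ) y y', (∀ j : Fin m, k ≤ j → y j = y' j) → s k y = s k y' :=
    fun k y y' h => by simp only [s, hfd k y y' h, mix_congr h]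
  -- `ρ` is `r` shifted by one with initial value 0, so `δ` lists the increments of `r`, beginning
  -- with `δ 0 = r 0`.
  let ρ : ℕ → ℝ := fun k => Nat.casesOn k 0 r
  let δ : ℕ → ℝ := fun k => ρ (k + 1) - ρ k
  have hδ : ∀ k, 0 ≤ δ k := fun k => by
    rcases k with _ | k
    · simpa [δ, ρ] using hr0.le
    · simpa [δ, ρ] using hr (Nat.le_succ k)
  have hδ0 : 0 < δ 0 := by simpa [δ, ρ] using hr0
  have hδsum : ∀ k, ∑ l ∈ Finset.range (k + 1), δ l = r k := fun k => by
    rw [Finset.sum_range_sub]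
    simp [ρ]
  -- The layer `s k` collapses the first `k` coordinates to a choice depending on the others without
  -- leaving the cube. Weighting layers by `δ k` stretches coordinate `i` by `δ 0 + ⋯ + δ i = r i`.
  let Φ : (Fin m → ℝ) → Fin m → ℝ := fun y => ∑ k ∈ Finset.range m, δ k • s k y
  -- Layers `k ≤ i` keep `y i`. Layers `k > i` contribute only a function of later coordinates. Thus
  -- `Φ` is a unitriangular map followed by `diag r`.
  have hΦ : ∀ y i, Φ y i = r i * (y i + (∑ k ∈ Finset.Ico (i + 1 : ℕ) m, δ k * f k y i) / r i) := by
    intro y i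
    have h1 : Φ y i = ∑ k ∈ Finset.range m, δ k * s k y i := by simp [Φ]
    rw [h1, ← Finset.sum_range_add_sum_Ico _ (Nat.succ_le_of_lt i.2), mul_add,
      mul_div_cancel₀ _ (hrpos i).ne', ← hδsum i, Finset.sum_mul]
    congr 1
    · refine Finset.sum_congr rfl fun k hk => ?_
      rw [hs_le k y i (Nat.lt_succ_iff.1 (Finset.mem_range.1 hk))]
    · refine Finset.sum_congr rfl fun k hk => ?_
      rw [hs_gt k y i (Nat.lt_of_succ_le (Finset.mem_Ico.1 hk).1)]
  let h : Fin m → (Fin m → ℝ) → ℝ := fun i y =>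
    (∑ k ∈ Finset.Ico (i + 1 : ℕ) m, δ k * f k y i) / r i
  have hmp := measurePreserving_unitriangular h
    (fun i => (Finset.measurable_sum _ fun k _ =>
      (((measurable_pi_apply i).comp (hfm k)).const_mul _)).div_const _)
    (fun i y y' hy => by
      simp only [h]
      congr 1
      refine Finset.sum_congr rfl fun k hk => ?_
      rw [hfd k y y' fun j hj => hy j
        (Fin.lt_def.2 (lt_of_lt_of_le (Nat.lt_of_succ_le (Finset.mem_Ico.1 hk).1) hj))])
  let S : (Fin m → ℝ) → Fin m → ℝ := fun y i => y i + h i y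
  let Dg : (Fin m → ℝ) →ₗ[ℝ] (Fin m → ℝ) := Matrix.toLin' (Matrix.diagonal fun i : Fin m => r i)
  have hDgS : ∀ y, Φ y = Dg (S y) := fun y => by
    ext i
    rw [hΦ]
    simp [Dg, S, h, Matrix.mulVec_diagonal]
  have hDet : LinearMap.det Dg = ∏ i : Fin m, r i := by
    simp [Dg, Matrix.det_diagonal]
  have hprod : 0 < ∏ i : Fin m, r i := Finset.prod_pos fun i _ => hrpos i
  have key : ∀ y ∈ B ⁻¹' C, ∀ y' ∈ B ⁻¹' C, y ≠ y' → ∃ k : Fin m, ‖B (Φ y) - B (Φ y')‖ < r k ∧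
      B (Φ y) - B (Φ y') ∉ Submodule.span ℝ (b '' {j | j < k}) := by
    intro y hy y' hy' hne
    have hne' : (Finset.univ.filter fun i => y i ≠ y' i).Nonempty := by
      obtain ⟨i, hi⟩ := Function.ne_iff.1 hne
      exact ⟨i, by simpa using hi⟩
    -- `K` is the last coordinate where the points differ. All layers beyond `K` agree, so the
    -- difference has norm below `δ 0 + ⋯ + δ K = r K`, while its `K`-th coordinate is `r K * (y K -
    -- y' K) ≠ 0`.
    obtain ⟨K, hK, hmax⟩ := Finset.exists_max_image _ id hne'
    have hK' : y K ≠ y' K := by simpa using hK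
    have hgt : ∀ j, K < j → y j = y' j := fun j hj => by
      by_contra hcon
      exact absurd (hmax j (by simpa using hcon)) (not_le.2 hj)
    have hdiff : Φ y - Φ y' = ∑ k ∈ Finset.range (K + 1), δ k • (s k y - s k y') := by
      simp only [Φ, ← Finset.sum_sub_distrib, ← smul_sub]
      rw [← Finset.sum_range_add_sum_Ico _ (Nat.succ_le_of_lt K.2)]
      refine add_eq_left.2 (Finset.sum_eq_zero fun k hk => ?_)
      rw [hs_congr k y y' fun j hj => hgt j
        (Fin.lt_def.2 (lt_of_lt_of_le (Nat.lt_of_succ_le (Finset.mem_Ico.1 hk).1) hj))]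
      simp
    refine ⟨K, ?_, ?_⟩
    · rw [← map_sub, hdiff, map_sum, pi_norm_lt_iff (hrpos K)]
      intro i
      rw [Finset.sum_apply]
      refine (norm_sum_le _ _).trans_lt ?_
      rw [← hδsum K]
      have hlt : ∀ k, ‖(B (s k y - s k y')) i‖ < 1 := fun k => by
        have h1 : (B (s k y)) i ∈ Set.Ioo (0 : ℝ) 1 := hfC k y hy i trivial
        have h2 : (B (s k y')) i ∈ Set.Ioo (0 : ℝ) 1 := hfC k y' hy' i trivial
        rw [map_sub, Pi.sub_apply, Real.norm_eq_abs, abs_lt]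
        constructor <;> linarith [h1.1, h1.2, h2.1, h2.2]
      have hterm : ∀ k, ‖(B (δ k • (s k y - s k y'))) i‖ = δ k * ‖(B (s k y - s k y')) i‖ :=
        fun k => by rw [map_smul, Pi.smul_apply, norm_smul, Real.norm_of_nonneg (hδ k)]
      simp only [hterm]
      refine Finset.sum_lt_sum (fun k _ => ?_) ⟨0, by simp, ?_⟩
      · exact mul_le_of_le_one_right (hδ k) (hlt k).le
      · exact mul_lt_of_lt_one_right hδ0 (hlt 0)
    · intro hmem
      have hz : b.repr (B (Φ y) - B (Φ y')) K = 0 := by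
        by_contra hcon
        have := (b.mem_span_image.1 hmem) (Finsupp.mem_support_iff.2 hcon)
        exact lt_irrefl K this
      have hrepr : ∀ u : Fin m → ℝ, b.repr (B u) K = u K := fun u => by
        have : b.equivFun (b.equivFun.symm u) = u := b.equivFun.apply_symm_apply u
        exact congrFun this K
      rw [← map_sub, hrepr, hdiff, Finset.sum_apply] at hz
      have : ∑ k ∈ Finset.range (K + 1), (δ k • (s k y - s k y')) K = r K * (y K - y' K) := by
        rw [← hδsum K, Finset.sum_mul]
        refine Finset.sum_congr rfl fun k hk => ?_
        have hk' : k ≤ K := Nat.lt_succ_iff.1 (Finset.mem_range.1 hk)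
        simp [hs_le k _ K hk']
      rw [this] at hz
      rcases mul_eq_zero.1 hz with h0 | h0
      · exact (hrpos K).ne' h0
      · exact hK' (sub_eq_zero.1 h0)
  have hinj : Set.InjOn Φ (B ⁻¹' C) := by
    intro y hy y' hy' heq
    by_contra hne
    obtain ⟨k, -, hk⟩ := key y hy y' hy' hne
    exact hk (by simp [heq])
  have hSinj : Set.InjOn S (B ⁻¹' C) := fun y hy y' hy' heq => hinj hy hy' (by
    rw [hDgS, hDgS, heq])
  have hSm : MeasurableSet (S '' (B ⁻¹' C)) :=
    hC'.measurableSet.image_of_measurable_injOn hmp.measurable hSinj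
  -- Injectivity on all of space is what identifies the preimage of `S '' (B ⁻¹' C)` with `B ⁻¹' C`.
  have hSinj' : Function.Injective S := by
    intro y y' heq
    by_contra hne
    have hne' : (Finset.univ.filter fun i => y i ≠ y' i).Nonempty := by
      obtain ⟨i, hi⟩ := Function.ne_iff.1 hne
      exact ⟨i, by simpa using hi⟩
    obtain ⟨K, hK, hmax⟩ := Finset.exists_max_image _ id hne'
    have hK' : y K ≠ y' K := by simpa using hK
    have hgt : ∀ j, K < j → y j = y' j := fun j hj => by
      by_contra hcon
      exact absurd (hmax j (by simpa using hcon)) (not_le.2 hj)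
    have h1 : y K + h K y = y' K + h K y' := congrFun heq K
    have h2 : h K y = h K y' := by
      simp only [h]
      congr 1
      refine Finset.sum_congr rfl fun k hk => ?_
      rw [hfd k y y' fun j hj => hgt j
        (Fin.lt_def.2 (lt_of_lt_of_le (Nat.lt_of_succ_le (Finset.mem_Ico.1 hk).1) hj))]
    exact hK' (by linarith)
  have hSvol : volume (S '' (B ⁻¹' C)) = volume (B ⁻¹' C) := by
    rw [← hmp.measure_preimage hSm.nullMeasurableSet]
    exact congrArg _ (Set.preimage_image_eq _ hSinj')
  have hΦimg : Φ '' (B ⁻¹' C) = Dg '' (S '' (B ⁻¹' C)) := by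
    rw [← Set.image_comp]
    exact Set.image_congr fun y _ => hDgS y
  have hΦvol : volume (Φ '' (B ⁻¹' C)) = ENNReal.ofReal (∏ i : Fin m, r i) * volume (B ⁻¹' C) := by
    rw [hΦimg, Measure.addHaar_image_linearMap, hDet, abs_of_pos hprod, hSvol]
  have hΦm : MeasurableSet (Φ '' (B ⁻¹' C)) := by
    refine hC'.measurableSet.image_of_measurable_injOn ?_ hinj
    have : Φ = Dg ∘ S := funext hDgS
    rw [this]
    exact (LinearMap.continuous_of_finiteDimensional Dg).measurable.comp hmp.measurable
  -- The Jacobian of `B` need not be computed: `ν` is a multiple of Lebesgue measure, hence scaled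
  -- by the same factor `∏ r i`, and it gives `B ⁻¹' C` the volume 1 of the cube.
  let ν : Measure (Fin m → ℝ) := (volume : Measure (ι → ℝ)).map B.symm
  have hν : ∀ X, ν X = volume (B '' X) := fun X => by
    have : ν X = volume (B.symm ⁻¹' X) := B.symm.toHomeomorph.toMeasurableEquiv.map_apply X
    rw [this, ContinuousLinearEquiv.image_eq_preimage_symm]
  have : ν.IsAddHaarMeasure := B.symm.isAddHaarMeasure_map _
  have hνs : ν = Measure.addHaarScalarFactor ν volume • volume :=
    Measure.isAddLeftInvariant_eq_smul ν volume
  refine ⟨B '' (Φ '' (B ⁻¹' C)), ?_, ?_, ?_⟩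
  · rw [ContinuousLinearEquiv.image_eq_preimage_symm]
    exact B.symm.continuous.measurable hΦm
  · have hone : ν (B ⁻¹' C) = 1 := by
      rw [hν, Set.image_preimage_eq _ B.surjective]
      simp [C, volume_pi_pi]
    rw [← hν, ← mul_one (ENNReal.ofReal _), ← hone]
    rw [hνs]
    simp only [Measure.smul_apply, hΦvol, ENNReal.smul_def, smul_eq_mul]
    ring
  · rintro _ ⟨_, ⟨y, hy, rfl⟩, rfl⟩ _ ⟨_, ⟨y', hy', rfl⟩, rfl⟩ hne
    exact key y hy y' hy' fun h => hne (by rw [h])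

/-! ### Lattices containing the integer lattice and their sup-norm minima -/

/-- A subgroup of `ι → ℝ` lying between `ℤ^ι` and `(1/D) ℤ^ι` for some `D > 0`. -/
structure IsFractionalLattice {ι : Type*} (L : AddSubgroup (ι → ℝ)) : Prop where
  int_mem : ∀ z : ι → ℤ, (fun i => (z i : ℝ)) ∈ L
  exists_denom : ∃ D : ℕ, 0 < D ∧ ∀ x ∈ L, ∀ i, ∃ z : ℤ, (D : ℝ) * x i = z

/-- A sequence of vectors of `L`, each of minimal norm among those outside the span of the
previous ones. -/
structure IsMinimalSeq {ι : Type*} [Fintype ι] (L : AddSubgroup (ι → ℝ)) (w : ℕ → ι → ℝ)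
    (k : ℕ) : Prop where
  mem : ∀ i < k, w i ∈ L
  notMem_span : ∀ i < k, w i ∉ Submodule.span ℝ (w '' Set.Iio i)
  norm_le : ∀ i < k, ∀ x ∈ L, x ∉ Submodule.span ℝ (w '' Set.Iio i) → ‖w i‖ ≤ ‖x‖

/-- The points of `L` in the half-open unit cube. -/
def unitPoints {ι : Type*} (L : AddSubgroup (ι → ℝ)) : Set (ι → ℝ) :=
  {x | x ∈ L ∧ ∀ i, x i ∈ Set.Ico (0 : ℝ) 1}

theorem linearIndependent_of_notMem_span {E : Type*} [AddCommGroup E] [Module ℝ E] {w : ℕ → E}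
    {k : ℕ} (h : ∀ i < k, w i ∉ Submodule.span ℝ (w '' Set.Iio i)) :
    LinearIndependent ℝ fun i : Fin k => w i := by
  induction k with
  | zero => exact linearIndependent_empty_type
  | succ k ih =>
    have hrange : Set.range (Fin.init fun i : Fin (k + 1) => w i) = w '' Set.Iio k := by
      ext x
      constructor
      · rintro ⟨i, rfl⟩
        exact ⟨i, i.2, rfl⟩
      · rintro ⟨i, hi, rfl⟩
        exact ⟨⟨i, hi⟩, rfl⟩
    rw [linearIndependent_finSucc', hrange]
    exact ⟨ih fun i hi => h i (hi.trans k.lt_succ_self), h k k.lt_succ_self⟩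

theorem finrank_span_image_Iio {E : Type*} [AddCommGroup E] [Module ℝ E] {w : ℕ → E}
    {k : ℕ} (h : ∀ i < k, w i ∉ Submodule.span ℝ (w '' Set.Iio i)) :
    Module.finrank ℝ (Submodule.span ℝ (w '' Set.Iio k)) = k := by
  have h1 : w '' Set.Iio k = Set.range fun i : Fin k => w i := by
    ext x
    constructor
    · rintro ⟨i, hi, rfl⟩
      exact ⟨⟨i, hi⟩, rfl⟩
    · rintro ⟨i, rfl⟩
      exact ⟨i, i.2, rfl⟩
  rw [h1, finrank_span_eq_card (linearIndependent_of_notMem_span h), Fintype.card_fin]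

theorem IsFractionalLattice.single_mem {ι : Type*} {L : AddSubgroup (ι → ℝ)}
    (hL : IsFractionalLattice L) [DecidableEq ι] (i : ι) :
    (Pi.single i 1 : ι → ℝ) ∈ L := by
  convert hL.int_mem (Pi.single i 1) using 1
  ext j
  by_cases hj : j = i
  · subst hj; simp
  · simp [hj]

namespace IsFractionalLattice

variable {ι : Type*} [Fintype ι] {L : AddSubgroup (ι → ℝ)}

theorem finite_norm_le (hL : IsFractionalLattice L) (R : ℝ) : {x | x ∈ L ∧ ‖x‖ ≤ R}.Finite := by
  classical
  obtain ⟨D, hD, hint⟩ := hL.exists_denom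
  have hD' : (0 : ℝ) < D := Nat.cast_pos.2 hD
  refine ((Set.Finite.pi' fun _ : ι => Set.finite_Icc (-⌈D * R⌉) ⌈D * R⌉).image
    fun (z : ι → ℤ) i => (z i : ℝ) / D).subset ?_
  rintro x ⟨hx, hxR⟩
  choose z hz using hint x hx
  refine ⟨z, fun i => ?_, ?_⟩
  · have h1 : |x i| ≤ R := (norm_le_pi_norm x i).trans hxR
    have h2 : |(z i : ℝ)| ≤ ⌈D * R⌉ := by
      rw [← hz, abs_mul, abs_of_pos hD']
      exact (mul_le_mul_of_nonneg_left h1 hD'.le).trans (Int.le_ceil _)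
    exact abs_le.1 (by exact_mod_cast h2)
  · ext i
    simp only [← hz]
    field_simp

theorem finite_unitPoints (hL : IsFractionalLattice L) : (unitPoints L).Finite := by
  refine (hL.finite_norm_le 1).subset fun x hx => ⟨hx.1, ?_⟩
  rw [pi_norm_le_iff_of_nonneg zero_le_one]
  intro i
  rw [Real.norm_of_nonneg (hx.2 i).1]
  exact (hx.2 i).2.le

theorem exists_single_notMem {V : Submodule ℝ (ι → ℝ)} [DecidableEq ι] (hV : V ≠ ⊤) :
    ∃ i, (Pi.single i 1 : ι → ℝ) ∉ V := by
  by_contra! hcon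
  refine hV (eq_top_iff.2 fun x _ => ?_)
  rw [pi_eq_sum_univ' x]
  exact V.sum_mem fun i _ => V.smul_mem _ (hcon i)

/-- Some standard unit vector lies outside `V`, and only finitely many lattice vectors are no longer
than it. -/
theorem exists_min_norm (hL : IsFractionalLattice L) {V : Submodule ℝ (ι → ℝ)} (hV : V ≠ ⊤) :
    ∃ x ∈ L, x ∉ V ∧ ∀ y ∈ L, y ∉ V → ‖x‖ ≤ ‖y‖ := by
  classical
  obtain ⟨i, hi⟩ := exists_single_notMem hV
  have hiL := hL.single_mem i
  obtain ⟨x, ⟨⟨hxL, hxn⟩, hxV⟩, hmin⟩ := Set.exists_min_image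
    ({x | x ∈ L ∧ ‖x‖ ≤ ‖(Pi.single i 1 : ι → ℝ)‖} ∩ {x | x ∉ V}) (fun x => ‖x‖)
    ((hL.finite_norm_le _).inter_of_left _) ⟨_, ⟨hiL, le_rfl⟩, hi⟩
  refine ⟨x, hxL, hxV, fun y hy hyV => ?_⟩
  rcases le_total ‖y‖ ‖(Pi.single i 1 : ι → ℝ)‖ with h | h
  · exact hmin y ⟨⟨hy, h⟩, hyV⟩
  · exact hxn.trans h

theorem exists_isMinimalSeq (hL : IsFractionalLattice L) {k : ℕ} (hk : k ≤ Fintype.card ι) :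
    ∃ w, IsMinimalSeq L w k := by
  classical
  induction k with
  | zero => exact ⟨0, by simp, by simp, by simp⟩
  | succ k ih =>
    obtain ⟨w, hw⟩ := ih (Nat.le_of_succ_le hk)
    have hV : Submodule.span ℝ (w '' Set.Iio k) ≠ ⊤ := fun h => by
      have := finrank_span_image_Iio hw.notMem_span
      rw [h, finrank_top, Module.finrank_fintype_fun_eq_card] at this
      omega
    obtain ⟨x, hxL, hxV, hmin⟩ := hL.exists_min_norm hV
    have himg : ∀ i ≤ k, Function.update w k x '' Set.Iio i = w '' Set.Iio i := fun i hi =>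
      Set.image_congr fun j hj => Function.update_of_ne (lt_of_lt_of_le hj hi).ne _ _
    refine ⟨Function.update w k x, ?_, ?_, ?_⟩
    · intro i hi
      rcases Nat.lt_succ_iff_lt_or_eq.1 hi with h | rfl
      · rw [Function.update_of_ne h.ne]
        exact hw.mem i h
      · rwa [Function.update_self]
    · intro i hi
      rw [himg i (Nat.lt_succ_iff.1 hi)]
      rcases Nat.lt_succ_iff_lt_or_eq.1 hi with h | rfl
      · rw [Function.update_of_ne h.ne]
        exact hw.notMem_span i h
      · rwa [Function.update_self]
    · intro i hi
      rw [himg i (Nat.lt_succ_iff.1 hi)]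
      rcases Nat.lt_succ_iff_lt_or_eq.1 hi with h | rfl
      · rw [Function.update_of_ne h.ne]
        exact hw.norm_le i h
      · rwa [Function.update_self]

end IsFractionalLattice

namespace IsMinimalSeq

variable {ι : Type*} [Fintype ι] {L : AddSubgroup (ι → ℝ)} {w : ℕ → ι → ℝ} {k : ℕ}

theorem norm_pos (hw : IsMinimalSeq L w k) {i : ℕ} (hi : i < k) : 0 < ‖w i‖ :=
  norm_pos_iff.2 fun h => hw.notMem_span i hi (h ▸ Submodule.zero_mem _)

theorem norm_mono (hw : IsMinimalSeq L w k) {i j : ℕ} (hij : i ≤ j) (hj : j < k) :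
    ‖w i‖ ≤ ‖w j‖ :=
  hw.norm_le i (hij.trans_lt hj) _ (hw.mem j hj) fun h => hw.notMem_span j hj
    (Submodule.span_mono (Set.image_mono (Set.Iio_subset_Iio hij)) h)

theorem linearIndependent (hw : IsMinimalSeq L w k) : LinearIndependent ℝ fun i : Fin k => w i :=
  linearIndependent_of_notMem_span hw.notMem_span

theorem mem_span_of_norm_lt (hw : IsMinimalSeq L w k) {i : ℕ} (hi : i < k) {x : ι → ℝ}
    (hx : x ∈ L) (hlt : ‖x‖ < ‖w i‖) : x ∈ Submodule.span ℝ (w '' Set.Iio i) := by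
  by_contra h
  exact (hw.norm_le i hi x hx h).not_gt hlt

end IsMinimalSeq

/-! ### Packing and Minkowski's second theorem -/

/-- If the nonzero elements of `L` avoid `P - P`, then `P` is a packing body for `L`. -/
theorem IsFractionalLattice.ncard_unitPoints_mul_volume_le {ι : Type*} [Fintype ι]
    {L : AddSubgroup (ι → ℝ)} (hL : IsFractionalLattice L) {P : Set (ι → ℝ)}
    (hP : MeasurableSet P) (hPL : ∀ x ∈ P, ∀ y ∈ P, x - y ∈ L → x = y) :
    ((unitPoints L).ncard : ENNReal) * volume P ≤ 1 := by
  classical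
  have hfin := hL.finite_unitPoints
  have hzL : ∀ z ∈ (Submodule.span ℤ (Set.range (Pi.basisFun ℝ ι))).toAddSubgroup,
      ∃ t : ι → ℤ, z = fun i => (t i : ℝ) := by
    intro z hz
    choose t ht using (Module.Basis.mem_span_iff_repr_mem ℤ (Pi.basisFun ℝ ι) z).1 hz
    exact ⟨t, funext fun i => by simpa using (ht i).symm⟩
  -- The union of these translates is one set meeting its integer translates trivially. By
  -- Blichfeldt's principle its volume cannot exceed that of the unit cube.
  have hdisj : (unitPoints L).PairwiseDisjoint fun a => a +ᵥ P := by
    intro a ha a' ha' hne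
    refine Set.disjoint_left.2 ?_
    rintro _ ⟨x, hx, rfl⟩ ⟨y, hy, hxy⟩
    have h1 : a' + y = a + x := hxy
    have h2 : x - y = a' - a := by rw [sub_eq_sub_iff_add_eq_add, add_comm x, h1, add_comm]
    have := hPL x hx y hy (h2 ▸ L.sub_mem ha'.1 ha.1)
    rw [this, sub_self] at h2
    exact hne (sub_eq_zero.1 h2.symm).symm
  have hvol : volume (⋃ a ∈ unitPoints L, a +ᵥ P) = ((unitPoints L).ncard : ENNReal) * volume P := by
    rw [measure_biUnion hfin.countable hdisj fun a _ => hP.const_vadd a]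
    simp only [measure_vadd]
    have := hfin.fintype
    rw [tsum_fintype, Finset.sum_const, nsmul_eq_mul, Finset.card_univ,
      ← Nat.card_eq_fintype_card, Nat.card_coe_set_eq]
  by_contra! hlt
  rw [← hvol] at hlt
  have hF : volume (ZSpan.fundamentalDomain (Pi.basisFun ℝ ι)) = 1 := by
    rw [ZSpan.fundamentalDomain_pi_basisFun, volume_pi_pi]
    simp
  rw [← hF] at hlt
  have : Countable (Submodule.span ℤ (Set.range (Pi.basisFun ℝ ι))).toAddSubgroup :=
    inferInstanceAs (Countable (Submodule.span ℤ (Set.range (Pi.basisFun ℝ ι))))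
  obtain ⟨z, z', hzz, hnd⟩ := exists_pair_mem_lattice_not_disjoint_vadd
    (ZSpan.isAddFundamentalDomain' (Pi.basisFun ℝ ι) volume)
    (MeasurableSet.biUnion hfin.countable fun a _ => hP.const_vadd a).nullMeasurableSet hlt
  obtain ⟨q, ⟨u, hu, rfl⟩, ⟨u', hu', heq⟩⟩ := Set.not_disjoint_iff.1 hnd
  simp only [Set.mem_iUnion] at hu hu'
  obtain ⟨a, ha, x, hx, rfl⟩ := hu
  obtain ⟨a', ha', y, hy, rfl⟩ := hu'
  have heq' : (z' : ι → ℝ) + (a' + y) = z + (a + x) := heq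
  obtain ⟨t, ht⟩ := hzL z z.2
  obtain ⟨t', ht'⟩ := hzL z' z'.2
  have hxy : x - y = (z' + a') - (z + a) := by
    rw [sub_eq_sub_iff_add_eq_add, add_assoc _ a' y, heq']
    abel
  have hxy0 := hPL x hx y hy (hxy ▸ L.sub_mem
    (L.add_mem (ht' ▸ hL.int_mem t') ha'.1) (L.add_mem (ht ▸ hL.int_mem t) ha.1))
  rw [hxy0, sub_self] at hxy
  refine hzz (Subtype.ext ?_)
  rw [ht, ht']
  funext i
  have hi : (t' i : ℝ) + a' i = t i + a i := by
    have := congrFun hxy i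
    rw [ht, ht'] at this
    simp only [Pi.zero_apply, Pi.sub_apply, Pi.add_apply] at this
    linarith
  -- Both `a` and `a'` lie in the half-open cube, so the integer translations are recovered as
  -- floors and must coincide.
  have h3 : ⌊(t' i : ℝ) + a' i⌋ = t' i := by
    rw [Int.floor_intCast_add, Int.floor_eq_zero_iff.2 (ha'.2 i), add_zero]
  have h4 : ⌊(t i : ℝ) + a i⌋ = t i := by
    rw [Int.floor_intCast_add, Int.floor_eq_zero_iff.2 (ha.2 i), add_zero]
  rw [← h3, ← h4, hi]

/-- **Minkowski's second theorem** for the sup norm. -/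
theorem IsFractionalLattice.ncard_unitPoints_mul_prod_le {ι : Type*} [Fintype ι]
    {L : AddSubgroup (ι → ℝ)} (hL : IsFractionalLattice L) {w : ℕ → ι → ℝ}
    (hw : IsMinimalSeq L w (Fintype.card ι)) :
    ((unitPoints L).ncard : ℝ) * ∏ i : Fin (Fintype.card ι), ‖w i‖ ≤ 1 := by
  classical
  rcases Nat.eq_zero_or_pos (Fintype.card ι) with h0 | hpos
  · have : IsEmpty ι := Fintype.card_eq_zero_iff.1 h0
    have h1 : (unitPoints L).ncard ≤ 1 := Set.ncard_le_one_of_subsingleton _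
    have h2 : ∏ i : Fin (Fintype.card ι), ‖w i‖ = 1 :=
      Finset.prod_eq_one fun i _ => absurd i.2 (by omega)
    rw [h2, mul_one]
    exact_mod_cast h1
  have hcard : Fintype.card (Fin (Fintype.card ι)) = Module.finrank ℝ (ι → ℝ) := by simp
  have : Nonempty (Fin (Fintype.card ι)) := ⟨⟨0, hpos⟩⟩
  let b := basisOfLinearIndependentOfCardEqFinrank hw.linearIndependent hcard
  have hb : ∀ i, b i = w i := fun i => by simp [b]
  -- The index is capped because `w` is controlled only below `Fintype.card ι`, while `r` must be
  -- monotone on all of `ℕ`.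
  let r : ℕ → ℝ := fun k => ‖w (min k (Fintype.card ι - 1))‖
  have hrw : ∀ i : Fin (Fintype.card ι), r i = ‖w i‖ := fun i => by
    simp only [r]
    rw [min_eq_left (by omega)]
  obtain ⟨P, hPm, hPvol, hP⟩ := exists_squeezed_cube b r
    (fun i j hij => hw.norm_mono (min_le_min_right _ hij) (by omega)) (hw.norm_pos (by omega))
  have hle := hL.ncard_unitPoints_mul_volume_le hPm fun x hx y hy hxy => by
    by_contra hne
    obtain ⟨k, hk, hk'⟩ := hP x hx y hy hne
    refine hk' ?_
    rw [hrw] at hk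
    have := hw.mem_span_of_norm_lt k.2 hxy hk
    refine Submodule.span_mono ?_ this
    rintro _ ⟨j, hj, rfl⟩
    exact ⟨⟨j, lt_trans hj k.2⟩, hj, hb _⟩
  rw [hPvol, ← ENNReal.ofReal_natCast, ← ENNReal.ofReal_mul (Nat.cast_nonneg _),
    ENNReal.ofReal_le_one] at hle
  simpa only [hrw] using hle

/-! ### Pivot coordinates of a flag -/

/-- Pivot coordinates for a flag of subspaces: a vector of the `r`-th subspace is determined by its
first `r` pivot coordinates. -/
theorem exists_pivots {ι : Type*} [Fintype ι] [Nonempty ι] (w : ℕ → ι → ℝ) {k : ℕ}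
    (h : ∀ i < k, w i ∉ Submodule.span ℝ (w '' Set.Iio i)) :
    ∃ c : ℕ → ι, (∀ i < k, ∀ j < k, c i = c j → i = j) ∧
      ∀ r ≤ k, ∀ x ∈ Submodule.span ℝ (w '' Set.Iio r), (∀ i < r, x (c i) = 0) → x = 0 := by
  classical
  induction k with
  | zero =>
    refine ⟨fun _ => Classical.arbitrary ι, by simp, fun r hr x hx _ => ?_⟩
    obtain rfl : r = 0 := by omega
    simpa using hx
  | succ k ih =>
    obtain ⟨c, hcinj, hc⟩ := ih fun i hi => h i (hi.trans k.lt_succ_self)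
    -- The `k` pivots found so far cannot separate a space of dimension `k + 1`. Any coordinate `j`
    -- where a nonzero kernel vector `v` does not vanish is a new pivot.
    let F : Submodule.span ℝ (w '' Set.Iio (k + 1)) →ₗ[ℝ] (Fin k → ℝ) :=
      (LinearMap.pi fun i : Fin k => LinearMap.proj (c i)) ∘ₗ Submodule.subtype _
    have hF : LinearMap.ker F ≠ ⊥ := F.ker_ne_bot_of_finrank_lt (by
      rw [finrank_span_image_Iio h, Module.finrank_fin_fun]
      exact k.lt_succ_self)
    obtain ⟨⟨v, hv⟩, hvF, hv0⟩ := (Submodule.ne_bot_iff _).1 hF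
    have hvc : ∀ i < k, v (c i) = 0 := fun i hi => congrFun (LinearMap.mem_ker.1 hvF) ⟨i, hi⟩
    have hv0' : v ≠ 0 := fun h0 => hv0 (Subtype.ext h0)
    obtain ⟨j, hj⟩ := Function.ne_iff.1 hv0'
    have hj : v j ≠ 0 := hj
    have hjc : ∀ i < k, c i ≠ j := fun i hi h0 => hj (h0 ▸ hvc i hi)
    have hlt : ∀ i < k, Function.update c k j i = c i := fun i hi => Function.update_of_ne hi.ne _ _
    refine ⟨Function.update c k j, ?_, ?_⟩
    · intro i hi i' hi' heq
      rcases Nat.lt_succ_iff_lt_or_eq.1 hi with h1 | rfl <;>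
        rcases Nat.lt_succ_iff_lt_or_eq.1 hi' with h2 | rfl
      · rw [hlt i h1, hlt i' h2] at heq
        exact hcinj i h1 i' h2 heq
      · rw [hlt i h1, Function.update_self] at heq
        exact absurd heq (hjc i h1)
      · rw [hlt i' h2, Function.update_self] at heq
        exact absurd heq.symm (hjc i' h2)
      · rfl
    · intro r hr x hx hxc
      rcases Nat.lt_succ_iff_lt_or_eq.1 (Nat.lt_succ_of_le hr) with h1 | rfl
      · exact hc r (Nat.lt_succ_iff.1 h1) x hx fun i hi => by
          rw [← hlt i (by omega)]
          exact hxc i hi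
      · have himg : w '' Set.Iio (k + 1) = insert (w k) (w '' Set.Iio k) := by
          rw [← Set.image_insert_eq]
          congr 1
          ext i
          simp only [Set.mem_Iio, Set.mem_insert_iff]
          omega
        rw [himg] at hx hv
        obtain ⟨a, x', hx', rfl⟩ := Submodule.mem_span_insert.1 hx
        obtain ⟨b, v', hv', rfl⟩ := Submodule.mem_span_insert.1 hv
        -- If `b = 0`, then `v` lies in the smaller span and vanishes at all its pivots. Since `b ≠
        -- 0`, subtracting `a / b` times `v` from `x` cancels `w k`, so `x` is a multiple of `v`,
        -- and the value at `j` forces it to be 0.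
        have hb : b ≠ 0 := by
          rintro rfl
          rw [zero_smul, zero_add] at hv0' hvc
          exact hv0' (hc k le_rfl v' hv' hvc)
        have hz : x' - (a / b) • v' = 0 := by
          refine hc k le_rfl _ (Submodule.sub_mem _ hx' (Submodule.smul_mem _ _ hv')) fun i hi => ?_
          have h1 := hxc i (by omega)
          have h2 := hvc i hi
          rw [hlt i hi] at h1
          simp only [Pi.add_apply, Pi.smul_apply, smul_eq_mul, Pi.sub_apply] at h1 h2 ⊢
          have h3 : x' (c i) = -(a * w k (c i)) := by linarith
          have h4 : v' (c i) = -(b * w k (c i)) := by linarith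
          rw [h3, h4]
          field_simp
          ring
        have hx : a • w k + x' = (a / b) • (b • w k + v') := by
          rw [sub_eq_zero.1 hz, smul_add, smul_smul, div_mul_cancel₀ _ hb]
        have h5 := hxc k k.lt_succ_self
        rw [hx, Function.update_self, Pi.smul_apply, smul_eq_mul] at h5
        rw [hx, (mul_eq_zero.1 h5).resolve_right hj, zero_smul]

theorem exists_perm_pivots {n : ℕ} (w : ℕ → Fin n → ℝ)
    (h : ∀ i < n, w i ∉ Submodule.span ℝ (w '' Set.Iio i)) :
    ∃ c : Equiv.Perm (Fin n), ∀ r ≤ n, ∀ x ∈ Submodule.span ℝ (w '' Set.Iio r),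
      (∀ i : Fin n, (i : ℕ) < r → x (c i) = 0) → x = 0 := by
  rcases n with _ | n
  · exact ⟨1, fun _ _ x _ _ => Subsingleton.elim _ _⟩
  · obtain ⟨c, hinj, hc⟩ := exists_pivots w h
    have hbij : Function.Bijective fun i : Fin (n + 1) => c i :=
      Finite.injective_iff_bijective.1 fun i j hij => Fin.ext (hinj i i.2 j j.2 hij)
    exact ⟨Equiv.ofBijective _ hbij, fun r hr x hx hxc => hc r hr x hx fun i hi =>
      hxc ⟨i, hi.trans_le hr⟩ hi⟩

/-! ### Sections by coordinate subspaces -/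

section restrict

variable {n : ℕ}

/-- Extension by zero of functions on `J`. -/
noncomputable def extendZero (J : Finset (Fin n)) : (J → ℝ) →ₗ[ℝ] (Fin n → ℝ) :=
  Function.ExtendByZero.linearMap ℝ Subtype.val

theorem extendZero_apply_mem {J : Finset (Fin n)} (x : J → ℝ) (j : J) : extendZero J x j = x j :=
  Subtype.val_injective.extend_apply _ _ _

theorem extendZero_apply_notMem {J : Finset (Fin n)} (x : J → ℝ) {i : Fin n} (hi : i ∉ J) :
    extendZero J x i = 0 :=
  Function.extend_apply' _ _ _ (by rintro ⟨j, rfl⟩; exact hi j.2)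

theorem extendZero_injective (J : Finset (Fin n)) : Function.Injective (extendZero J) :=
  fun x y h => funext fun j => by
    rw [← extendZero_apply_mem x, ← extendZero_apply_mem y, h]

theorem norm_extendZero_le {J : Finset (Fin n)} (x : J → ℝ) : ‖extendZero J x‖ ≤ ‖x‖ := by
  rw [pi_norm_le_iff_of_nonneg (norm_nonneg _)]
  intro i
  by_cases hi : i ∈ J
  · rw [extendZero_apply_mem x ⟨i, hi⟩]
    exact norm_le_pi_norm x _
  · rw [extendZero_apply_notMem x hi, norm_zero]
    exact norm_nonneg _

/-- The section of `L` by the coordinate subspace of `J`. -/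
noncomputable def coordSection (L : AddSubgroup (Fin n → ℝ)) (J : Finset (Fin n)) :
    AddSubgroup (J → ℝ) :=
  L.comap (extendZero J).toAddMonoidHom

theorem mem_coordSection {L : AddSubgroup (Fin n → ℝ)} {J : Finset (Fin n)} {x : J → ℝ} :
    x ∈ coordSection L J ↔ extendZero J x ∈ L := Iff.rfl

theorem IsFractionalLattice.coordSection {L : AddSubgroup (Fin n → ℝ)} (hL : IsFractionalLattice L)
    (J : Finset (Fin n)) : IsFractionalLattice (coordSection L J) where
  int_mem z := by
    rw [mem_coordSection]
    convert hL.int_mem (fun i => if hi : i ∈ J then z ⟨i, hi⟩ else 0) using 1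
    ext i
    by_cases hi : i ∈ J
    · simpa [hi] using extendZero_apply_mem _ (⟨i, hi⟩ : J)
    · simpa [hi] using extendZero_apply_notMem _ hi
  exists_denom := by
    obtain ⟨D, hD, h⟩ := hL.exists_denom
    exact ⟨D, hD, fun x hx j => by simpa [extendZero_apply_mem] using h _ hx j⟩

/-- The points of `L` in the half-open unit cube that are supported in `J`. -/
def supportedPoints (L : AddSubgroup (Fin n → ℝ)) (J : Finset (Fin n)) : Set (Fin n → ℝ) :=
  {x | x ∈ unitPoints L ∧ ∀ i ∉ J, x i = 0}

/-- Restriction to `J` loses nothing for points vanishing off `J`. Only this inequality is needed to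
pass to the section. -/
theorem IsFractionalLattice.ncard_supportedPoints_le {L : AddSubgroup (Fin n → ℝ)}
    (hL : IsFractionalLattice L) (J : Finset (Fin n)) :
    (supportedPoints L J).ncard ≤ (unitPoints (EhrhartMinima.coordSection L J)).ncard := by
  have hext : ∀ x ∈ supportedPoints L J, extendZero J (fun j => x j) = x := fun x hx => by
    ext i
    by_cases hi : i ∈ J
    · exact extendZero_apply_mem _ (⟨i, hi⟩ : J)
    · rw [extendZero_apply_notMem _ hi, hx.2 i hi]
  refine Set.ncard_le_ncard_of_injOn (fun x (j : J) => x j) ?_ ?_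
    (hL.coordSection J).finite_unitPoints
  · intro x hx
    refine ⟨?_, fun j => hx.1.2 j⟩
    rw [mem_coordSection]
    rw [hext x hx]
    exact hx.1.1
  · intro x hx y hy hxy
    rw [← hext x hx, ← hext y hy]
    exact congrArg _ hxy

/-- Otherwise `u 0, …, u i`, extended by zero, are shorter than `w (e i)` and lie in the span of the
`w l` with `l < e i`. A vector of that span is determined by its pivots `c l`, `l < e i`. If it also
vanishes off `J`, only the `i` pivots `c (e q)`, `q < i`, matter, which leaves no room for `i + 1`
independent vectors. -/
theorem IsMinimalSeq.norm_le_of_coordSection {L : AddSubgroup (Fin n → ℝ)} {w : ℕ → Fin n → ℝ}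
    (hw : IsMinimalSeq L w n) {c : Equiv.Perm (Fin n)}
    (hc : ∀ r ≤ n, ∀ x ∈ Submodule.span ℝ (w '' Set.Iio r),
      (∀ i : Fin n, (i : ℕ) < r → x (c i) = 0) → x = 0)
    {J : Finset (Fin n)} {u : ℕ → J → ℝ} {m : ℕ}
    (hu : IsMinimalSeq (coordSection L J) u m) (e : Fin m ↪o Fin n)
    (he : ∀ l, c l ∈ J → l ∈ Set.range e) (i : Fin m) : ‖w (e i)‖ ≤ ‖u i‖ := by
  by_contra! hlt
  have hmem : ∀ q : Fin (i + 1), extendZero J (u q) ∈ Submodule.span ℝ (w '' Set.Iio (e i : ℕ)) := by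
    intro q
    have hq : (q : ℕ) ≤ i := Nat.lt_succ_iff.1 q.2
    refine hw.mem_span_of_norm_lt (e i).2 (hu.mem q (hq.trans_lt i.2)) ?_
    exact ((norm_extendZero_le _).trans (hu.norm_mono hq i.2)).trans_lt hlt
  let G : (Fin (i + 1) → ℝ) →ₗ[ℝ] (Fin n → ℝ) :=
    extendZero J ∘ₗ Fintype.linearCombination ℝ fun q : Fin (i + 1) => u q
  have hG : ∀ a, G a ∈ Submodule.span ℝ (w '' Set.Iio (e i : ℕ)) := fun a => by
    simp only [G, LinearMap.comp_apply, Fintype.linearCombination_apply, map_sum, map_smul]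
    exact Submodule.sum_mem _ fun q _ => Submodule.smul_mem _ _ (hmem q)
  let F : (Fin (i + 1) → ℝ) →ₗ[ℝ] (Fin i → ℝ) :=
    (LinearMap.pi fun q : Fin i => LinearMap.proj (c (e (q.castLE i.2.le)))) ∘ₗ G
  have hF : LinearMap.ker F ≠ ⊥ := F.ker_ne_bot_of_finrank_lt (by simp)
  obtain ⟨a, ha, ha0⟩ := (Submodule.ne_bot_iff _).1 hF
  have hGa : G a = 0 := by
    refine hc _ (e i).2.le _ (hG a) fun l hl => ?_
    by_cases hlJ : c l ∈ J
    · obtain ⟨q, rfl⟩ := he l hlJ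
      have hqi : q < i := e.lt_iff_lt.1 hl
      exact congrFun (LinearMap.mem_ker.1 ha) ⟨q, hqi⟩
    · exact extendZero_apply_notMem _ hlJ
  have hli : LinearIndependent ℝ fun q : Fin (i + 1) => u q :=
    linearIndependent_of_notMem_span fun q hq => hu.notMem_span q (by omega)
  have hlc : Fintype.linearCombination ℝ (fun q : Fin (i + 1) => u q) a = 0 :=
    extendZero_injective J (hGa.trans (map_zero _).symm)
  exact ha0 (funext (Fintype.linearIndependent_iff.1 hli a
    (by simpa [Fintype.linearCombination_apply] using hlc)))

/-- Minkowski's second theorem is applied to the section over `J = c(K)`. Its minima dominate the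
`‖w i‖`, `i ∈ K`, when both are listed in increasing order of index. -/
theorem IsFractionalLattice.ncard_supportedPoints_mul_prod_le {L : AddSubgroup (Fin n → ℝ)}
    (hL : IsFractionalLattice L) {w : ℕ → Fin n → ℝ}
    (hw : IsMinimalSeq L w n) {c : Equiv.Perm (Fin n)}
    (hc : ∀ r ≤ n, ∀ x ∈ Submodule.span ℝ (w '' Set.Iio r),
      (∀ i : Fin n, (i : ℕ) < r → x (c i) = 0) → x = 0) (K : Finset (Fin n)) :
    ((supportedPoints L (K.map c.toEmbedding)).ncard : ℝ) * ∏ i ∈ K, ‖w i‖ ≤ 1 := by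
  set J := K.map c.toEmbedding with hJ
  have hcard : K.card = Fintype.card J := by
    rw [Fintype.card_coe, hJ, Finset.card_map]
  obtain ⟨u, hu⟩ := (hL.coordSection J).exists_isMinimalSeq le_rfl
  have hprod : ∏ i ∈ K, ‖w i‖ = ∏ i : Fin (Fintype.card J), ‖w (K.orderEmbOfFin hcard i)‖ := by
    rw [← Finset.prod_coe_sort, ← (K.orderIsoOfFin hcard).toEquiv.prod_comp]
    rfl
  rw [hprod]
  refine le_trans ?_ ((hL.coordSection J).ncard_unitPoints_mul_prod_le hu)
  refine mul_le_mul (by exact_mod_cast hL.ncard_supportedPoints_le J) ?_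
    (Finset.prod_nonneg fun _ _ => norm_nonneg _) (Nat.cast_nonneg _)
  refine Finset.prod_le_prod (fun _ _ => norm_nonneg _) fun i _ => ?_
  refine hw.norm_le_of_coordSection hc hu _ (fun l hl => ?_) i
  rw [Finset.range_orderEmbOfFin]
  simpa [hJ] using hl

/-- The number of lattice points of the `i`-dimensional coordinate faces of the half-open cube is
bounded by the elementary symmetric function of the inverse minima. -/
theorem IsFractionalLattice.sum_ncard_supportedPoints_le {L : AddSubgroup (Fin n → ℝ)}
    (hL : IsFractionalLattice L) {w : ℕ → Fin n → ℝ} (hw : IsMinimalSeq L w n) (i : ℕ) :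
    ∑ J ∈ Finset.powersetCard i (Finset.univ : Finset (Fin n)),
      ((supportedPoints L J).ncard : ℝ) ≤ sigma i fun j : Fin n => 1 / ‖w j‖ := by
  obtain ⟨c, hc⟩ := exists_perm_pivots w hw.notMem_span
  -- Every `i`-subset is `c(K)` for exactly one `i`-subset `K`.
  have hmap : Finset.powersetCard i (Finset.univ : Finset (Fin n)) =
      (Finset.powersetCard i (Finset.univ : Finset (Fin n))).map
        (Finset.mapEmbedding c.toEmbedding).toEmbedding := by
    rw [← Finset.powersetCard_map]
    simp
  rw [hmap, Finset.sum_map]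
  refine Finset.sum_le_sum fun K _ => ?_
  have hpos : 0 < ∏ j ∈ K, ‖w j‖ := Finset.prod_pos fun j _ => hw.norm_pos j.2
  have := hL.ncard_supportedPoints_mul_prod_le hw hc K
  rw [Finset.prod_div_distrib, Finset.prod_const_one, le_div_iff₀ hpos]
  exact this

end restrict

/-! ### Counting lattice points in dilated cubes -/

section counting

variable {n : ℕ}

/-- The points of a fractional lattice in the cube `[0, k]ⁿ` are counted by a polynomial in `k`. -/
theorem IsFractionalLattice.ncard_box {L : AddSubgroup (Fin n → ℝ)} (hL : IsFractionalLattice L)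
    (k : ℕ) :
    (({x | x ∈ L ∧ ∀ i, x i ∈ Set.Icc (0 : ℝ) k} : Set (Fin n → ℝ)).ncard : ℝ) =
      ∑ i : Fin (n + 1), (∑ J ∈ Finset.powersetCard i (Finset.univ : Finset (Fin n)),
        ((supportedPoints L J).ncard : ℝ)) * (k : ℝ) ^ (i : ℕ) := by
  classical
  have hfin := hL.finite_unitPoints
  let A : Finset (Fin n → ℝ) := hfin.toFinset
  have hA : ∀ β, β ∈ A ↔ β ∈ unitPoints L := fun β => hfin.mem_toFinset
  -- With `0 ≤ β i < 1`, an integer `z` satisfies `β i + z ≤ k` exactly when `z ≤ k` if `β i = 0`,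
  -- and `z ≤ k - 1` otherwise. For `k = 0` the second range is empty.
  let S : Finset (Σ _ : Fin n → ℝ, Fin n → ℤ) := A.sigma fun β =>
    Fintype.piFinset fun i => Finset.Icc (0 : ℤ) (if β i = 0 then k else k - 1)
  let g : (Σ _ : Fin n → ℝ, Fin n → ℤ) → Fin n → ℝ := fun p i => p.1 i + p.2 i
  have himg : ({x | x ∈ L ∧ ∀ i, x i ∈ Set.Icc (0 : ℝ) k} : Set (Fin n → ℝ)) = g '' S := by
    ext x
    constructor
    · rintro ⟨hxL, hx⟩
      refine ⟨⟨fun i => Int.fract (x i), fun i => ⌊x i⌋⟩, ?_, ?_⟩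
      · refine Finset.mem_coe.2 (Finset.mem_sigma.2 ⟨(hA _).2 ⟨?_, fun i =>
          ⟨Int.fract_nonneg _, Int.fract_lt_one _⟩⟩, Fintype.mem_piFinset.2 fun i => ?_⟩)
        · exact L.sub_mem hxL (hL.int_mem fun i => ⌊x i⌋)
        · rw [Finset.mem_Icc]
          refine ⟨Int.floor_nonneg.2 (hx i).1, ?_⟩
          have hle : ⌊x i⌋ ≤ (k : ℤ) := by
            have := Int.floor_mono (hx i).2
            simpa using this
          split_ifs with h0
          · exact hle
          · refine Int.le_sub_one_of_lt (lt_of_le_of_ne hle fun heq => h0 ?_)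
            have h1 : (⌊x i⌋ : ℝ) = k := by exact_mod_cast congrArg (Int.cast : ℤ → ℝ) heq
            have h2 := (hx i).2
            have h3 := Int.floor_le (x i)
            change x i - ⌊x i⌋ = 0
            linarith
      · funext i
        exact Int.fract_add_floor (x i)
    · rintro ⟨⟨β, z⟩, hS, rfl⟩
      obtain ⟨hβ, hz⟩ := Finset.mem_sigma.1 (Finset.mem_coe.1 hS)
      have hβ' := (hA β).1 hβ
      refine ⟨L.add_mem hβ'.1 (hL.int_mem z), fun i => ?_⟩
      have hzi := Finset.mem_Icc.1 (Fintype.mem_piFinset.1 hz i)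
      have hz0 : (0 : ℝ) ≤ z i := by exact_mod_cast hzi.1
      have hβi := hβ'.2 i
      refine ⟨add_nonneg hβi.1 hz0, ?_⟩
      have hz1 := hzi.2
      change β i + z i ≤ k
      dsimp only at hz1
      split_ifs at hz1 with h0
      · rw [h0, zero_add]
        exact_mod_cast hz1
      · have : (z i : ℝ) ≤ k - 1 := by exact_mod_cast hz1
        linarith [hβi.2]
  have hinj : Set.InjOn g S := by
    rintro ⟨β, z⟩ hS ⟨β', z'⟩ hS' heq
    have hβ := (hA β).1 (Finset.mem_sigma.1 (Finset.mem_coe.1 hS)).1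
    have hβ' := (hA β').1 (Finset.mem_sigma.1 (Finset.mem_coe.1 hS')).1
    have hzz : z = z' := by
      funext i
      have hi : β i + z i = β' i + z' i := congrFun heq i
      have h3 : ⌊β i + (z i : ℝ)⌋ = z i := by
        rw [Int.floor_add_intCast, Int.floor_eq_zero_iff.2 (hβ.2 i), zero_add]
      have h4 : ⌊β' i + (z' i : ℝ)⌋ = z' i := by
        rw [Int.floor_add_intCast, Int.floor_eq_zero_iff.2 (hβ'.2 i), zero_add]
      rw [← h3, ← h4, hi]
    subst hzz
    have : β = β' := funext fun i => add_right_cancel (congrFun heq i : β i + z i = β' i + z i)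
    rw [this]
  have hcardI : ∀ (β : Fin n → ℝ) (i : Fin n),
      ((Finset.Icc (0 : ℤ) (if β i = 0 then k else k - 1)).card : ℝ) =
        k + if β i = 0 then 1 else 0 := fun β i => by
    split_ifs
    · rw [Int.card_Icc, show (k : ℤ) + 1 - 0 = ((k + 1 : ℕ) : ℤ) by push_cast; ring,
        Int.toNat_natCast]
      push_cast
      rfl
    · simp [Int.card_Icc]
  have hsupp : ∀ J : Finset (Fin n), ((supportedPoints L J).ncard : ℝ) =
      ∑ β ∈ A, ∏ i ∈ Finset.univ \ J, if β i = 0 then (1 : ℝ) else 0 := fun J => by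
    have h1 : supportedPoints L J = (A.filter fun β => ∀ i ∈ Finset.univ \ J, β i = 0 :
        Finset (Fin n → ℝ)) := by
      ext β
      simp [supportedPoints, hA]
    rw [h1, Set.ncard_coe_finset, Finset.card_filter]
    push_cast
    refine Finset.sum_congr rfl fun β _ => ?_
    rw [Finset.prod_ite_zero]
    simp
  rw [himg, hinj.ncard_image, Set.ncard_coe_finset, Finset.card_sigma]
  push_cast
  simp only [Fintype.card_piFinset]
  push_cast
  -- In the expansion `J` is the set of factors contributing `k`. The remaining indicators require
  -- `β` to vanish off `J`.
  simp only [hcardI, Finset.prod_add]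
  rw [Finset.sum_comm, Finset.sum_powerset, Finset.card_univ, Fintype.card_fin,
    Finset.sum_range]
  refine Finset.sum_congr rfl fun i _ => ?_
  rw [Finset.sum_mul]
  refine Finset.sum_congr rfl fun J hJ => ?_
  rw [hsupp, Finset.sum_mul]
  refine Finset.sum_congr rfl fun β _ => ?_
  rw [Finset.prod_const, (Finset.mem_powersetCard.1 hJ).2, mul_comm]

end counting

/-! ### Parallelepipeds in the coordinates of their edges -/

section parallelepiped

variable {n : ℕ}

/-- The integer lattice as a subgroup. -/
def integerSubgroup (n : ℕ) : AddSubgroup (Fin n → ℝ) where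
  carrier := integerLattice n
  zero_mem' := ⟨0, by ext; simp⟩
  add_mem' := by
    rintro _ _ ⟨z, rfl⟩ ⟨z', rfl⟩
    exact ⟨z + z', by ext; simp⟩
  neg_mem' := by
    rintro _ ⟨z, rfl⟩
    exact ⟨-z, by ext; simp⟩

/-- The integer lattice in the coordinates given by `v`. -/
def relLattice (v : Fin n → Fin n → ℝ) : AddSubgroup (Fin n → ℝ) :=
  (integerSubgroup n).comap (Fintype.linearCombination ℝ v).toAddMonoidHom

theorem mem_relLattice {v : Fin n → Fin n → ℝ} {a : Fin n → ℝ} :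
    a ∈ relLattice v ↔ Fintype.linearCombination ℝ v a ∈ integerLattice n := Iff.rfl

/-- The denominator is `|det M|`, where `M` has rows `v j`: from `x M = z` with `z` integral, `det M
• x = z adj M` is integral. -/
theorem isFractionalLattice_relLattice {v : Fin n → Fin n → ℝ} (hv : ∀ j, v j ∈ integerLattice n)
    (hli : LinearIndependent ℝ v) : IsFractionalLattice (relLattice v) where
  int_mem z := by
    rw [mem_relLattice, Fintype.linearCombination_apply]
    refine (integerSubgroup n).sum_mem fun j _ => ?_
    rw [Int.cast_smul_eq_zsmul]
    exact (integerSubgroup n).zsmul_mem (hv j) _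
  exists_denom := by
    choose V hV using hv
    let M : Matrix (Fin n) (Fin n) ℤ := Matrix.of V
    have hM : M.map (Int.castRingHom ℝ) = Matrix.of v := by
      ext i j
      exact congrFun (hV i) j
    have hdet : M.det ≠ 0 := fun h0 => by
      have h1 : IsUnit (Matrix.of v) := Matrix.linearIndependent_rows_iff_isUnit.1 hli
      rw [Matrix.isUnit_iff_isUnit_det, ← hM] at h1
      have h2 : (M.map (Int.castRingHom ℝ)).det = 0 := by
        have := (Int.castRingHom ℝ).map_det M
        rw [h0, map_zero] at this
        exact this.symm
      rw [h2] at h1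
      exact not_isUnit_zero h1
    have hdenom : ∀ x ∈ relLattice v, ∀ i, ∃ z : ℤ, (M.det : ℝ) * x i = z := by
      intro x hx i
      obtain ⟨z, hz⟩ := mem_relLattice.1 hx
      refine ⟨Matrix.vecMul z M.adjugate i, ?_⟩
      have h1 : Matrix.vecMul x (M.map (Int.castRingHom ℝ)) = fun j => (z j : ℝ) := by
        rw [hM]
        refine Eq.trans ?_ hz.symm
        ext j
        simp [Matrix.vecMul, dotProduct, Fintype.linearCombination_apply]
      have h2 : (M.map (Int.castRingHom ℝ)) * (M.adjugate.map (Int.castRingHom ℝ)) =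
          (M.det : ℝ) • (1 : Matrix (Fin n) (Fin n) ℝ) := by
        rw [← Matrix.map_mul, Matrix.mul_adjugate]
        ext a b
        rw [Matrix.map_apply, Matrix.smul_apply, Matrix.smul_apply, Matrix.one_apply,
          Matrix.one_apply]
        split_ifs <;> simp
      have h3 := congrFun (congrArg (fun y => Matrix.vecMul y (M.adjugate.map (Int.castRingHom ℝ))) h1) i
      simp only [Matrix.vecMul_vecMul, h2, Matrix.vecMul_smul, Matrix.vecMul_one, Pi.smul_apply,
        smul_eq_mul] at h3
      rw [h3]
      simp [Matrix.vecMul, dotProduct]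
    refine ⟨M.det.natAbs, Int.natAbs_pos.2 hdet, fun x hx i => ?_⟩
    obtain ⟨z, hz⟩ := hdenom x hx i
    have h1 : ((M.det.natAbs : ℕ) : ℝ) = |(M.det : ℝ)| := by
      rw [Nat.cast_natAbs, Int.cast_abs]
    rcases abs_choice (M.det : ℝ) with h | h
    · exact ⟨z, by rw [h1, h, hz]⟩
    · exact ⟨-z, by rw [h1, h, neg_mul, hz, Int.cast_neg]⟩

theorem linearCombination_injective {v : Fin n → Fin n → ℝ} (hli : LinearIndependent ℝ v) :
    Function.Injective (Fintype.linearCombination ℝ v) :=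
  (injective_iff_map_eq_zero _).2 fun a ha => funext (Fintype.linearIndependent_iff.1 hli a
    (by simpa [Fintype.linearCombination_apply] using ha))

theorem parallelepiped_eq_image (v : Fin n → Fin n → ℝ) :
    parallelepiped v = Fintype.linearCombination ℝ v '' Set.Icc 0 1 := by
  rfl

theorem isEhrhartCoeffs_parallelepiped {p : Fin n → ℝ} (hp : p ∈ integerLattice n)
    {v : Fin n → Fin n → ℝ} (hv : ∀ j, v j ∈ integerLattice n) (hli : LinearIndependent ℝ v) :
    IsEhrhartCoeffs (p +ᵥ parallelepiped v) fun i : Fin (n + 1) =>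
      ∑ J ∈ Finset.powersetCard i (Finset.univ : Finset (Fin n)),
        ((supportedPoints (relLattice v) J).ncard : ℝ) := by
  intro k
  rw [← (isFractionalLattice_relLattice hv hli).ncard_box k]
  set T := Fintype.linearCombination ℝ v with hT
  have hkp : (k : ℝ) • p ∈ integerSubgroup n := by
    rw [Nat.cast_smul_eq_nsmul]
    exact (integerSubgroup n).nsmul_mem hp k
  have hset : (k : ℝ) • (p +ᵥ parallelepiped v) ∩ integerLattice n =
      (fun a => (k : ℝ) • p + T a) '' {x | x ∈ relLattice v ∧ ∀ i, x i ∈ Set.Icc (0 : ℝ) k} := by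
    ext x
    constructor
    · rintro ⟨⟨_, ⟨y, hy, rfl⟩, rfl⟩, hx⟩
      rw [parallelepiped_eq_image] at hy
      obtain ⟨t, ht, rfl⟩ := hy
      have heq : (k : ℝ) • p + T ((k : ℝ) • t) = (k : ℝ) • (p +ᵥ T t) := by
        rw [map_smul, vadd_eq_add, smul_add]
      refine ⟨(k : ℝ) • t, ⟨?_, fun i => ?_⟩, heq⟩
      · have := (integerSubgroup n).sub_mem hx hkp
        simp only at this
        rw [← hT, ← heq, add_sub_cancel_left] at this
        exact this
      · exact ⟨mul_nonneg (Nat.cast_nonneg k) (ht.1 i),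
          mul_le_of_le_one_right (Nat.cast_nonneg k) (ht.2 i)⟩
    · rintro ⟨a, ⟨haL, ha⟩, rfl⟩
      -- For `k = 0` the quotient `a i / k` is 0 by convention, which is harmless because then `a =
      -- 0`.
      refine ⟨⟨p +ᵥ T fun i => a i / k, ⟨_, ?_, rfl⟩, ?_⟩, (integerSubgroup n).add_mem hkp haL⟩
      · rw [parallelepiped_eq_image]
        exact ⟨_, ⟨fun i => div_nonneg (ha i).1 (Nat.cast_nonneg k),
          fun i => div_le_one_of_le₀ (ha i).2 (Nat.cast_nonneg k)⟩, rfl⟩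
      · change (k : ℝ) • (p + T fun i => a i / k) = (k : ℝ) • p + T a
        rw [smul_add, ← map_smul]
        congr 2
        funext i
        rcases Nat.eq_zero_or_pos k with rfl | hk
        · have := ha i
          simp only [Nat.cast_zero, Set.Icc_self, Set.mem_singleton_iff] at this
          simp [this]
        · have : (k : ℝ) ≠ 0 := Nat.cast_ne_zero.2 hk.ne'
          simp only [Pi.smul_apply, smul_eq_mul]
          field_simp
  rw [latticePoints, hset, Set.ncard_image_of_injective]
  exact (add_right_injective _).comp (linearCombination_injective hli)

theorem smul_sub_parallelepiped (p : Fin n → ℝ) (v : Fin n → Fin n → ℝ) {t : ℝ} (ht : 0 < t) :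
    t • ((p +ᵥ parallelepiped v) - (p +ᵥ parallelepiped v)) =
      Fintype.linearCombination ℝ v '' {a | ‖a‖ ≤ t} := by
  rw [parallelepiped_eq_image]
  set T := Fintype.linearCombination ℝ v
  ext x
  constructor
  · rintro ⟨_, ⟨_, ⟨_, ⟨a, ha, rfl⟩, rfl⟩, _, ⟨_, ⟨b, hb, rfl⟩, rfl⟩, rfl⟩, rfl⟩
    refine ⟨t • (a - b), ?_, ?_⟩
    · rw [Set.mem_ofPred_eq, norm_smul, Real.norm_of_nonneg ht.le]
      refine mul_le_of_le_one_right ht.le ((pi_norm_le_iff_of_nonneg zero_le_one).2 fun i => ?_)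
      rw [Pi.sub_apply, Real.norm_eq_abs, abs_le]
      have h1 := ha.1 i
      have h2 := ha.2 i
      have h3 := hb.1 i
      have h4 := hb.2 i
      simp only [Pi.zero_apply, Pi.one_apply] at h1 h2 h3 h4
      constructor <;> linarith
    · simp
  · rintro ⟨a, ha, rfl⟩
    have hi : ∀ i, |a i| ≤ t := fun i => (norm_le_pi_norm a i).trans ha
    have hi' : ∀ i, |a i / t| ≤ 1 := fun i => by
      rw [abs_div, abs_of_pos ht, div_le_one ht]
      exact hi i
    -- The vector `a / t` in `[-1,1]ⁿ` is the difference of `(1 + a / t) / 2` and `(1 - a / t) / 2`,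
    -- both in the unit cube.
    refine ⟨_, ⟨_, ⟨_, ⟨fun i => (1 + a i / t) / 2, ⟨fun i => ?_, fun i => ?_⟩, rfl⟩, rfl⟩,
      _, ⟨_, ⟨fun i => (1 - a i / t) / 2, ⟨fun i => ?_, fun i => ?_⟩, rfl⟩, rfl⟩, rfl⟩, ?_⟩
    iterate 4
      · have := abs_le.1 (hi' i)
        simp only [Pi.zero_apply, Pi.one_apply]
        linarith [this.1, this.2]
    · simp only [vadd_eq_add, add_sub_add_left_eq_sub, ← map_sub, ← map_smul]
      congr 1
      ext i
      simp only [Pi.smul_apply, Pi.sub_apply, smul_eq_mul]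
      field_simp
      ring

theorem affineDim_eq_finrank_span (p : Fin n → ℝ) {v : Fin n → Fin n → ℝ}
    (hli : LinearIndependent ℝ v) {t : ℝ} (ht : 0 < t) :
    affineDim (t • ((p +ᵥ parallelepiped v) - (p +ᵥ parallelepiped v)) ∩ integerLattice n) =
      Module.finrank ℝ (Submodule.span ℝ {a | a ∈ relLattice v ∧ ‖a‖ ≤ t}) := by
  have hset : t • ((p +ᵥ parallelepiped v) - (p +ᵥ parallelepiped v)) ∩ integerLattice n =
      Fintype.linearCombination ℝ v '' {a | a ∈ relLattice v ∧ ‖a‖ ≤ t} := by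
    rw [smul_sub_parallelepiped p v ht]
    ext x
    constructor
    · rintro ⟨⟨a, ha, rfl⟩, hx⟩
      exact ⟨a, ⟨hx, ha⟩, rfl⟩
    · rintro ⟨a, ⟨hx, ha⟩, rfl⟩
      exact ⟨⟨a, ha, rfl⟩, hx⟩
  -- Since the set contains 0, the direction of its affine hull is its linear span.
  have h0 : (0 : Fin n → ℝ) ∈
      Fintype.linearCombination ℝ v '' {a | a ∈ relLattice v ∧ ‖a‖ ≤ t} :=
    ⟨0, ⟨(relLattice v).zero_mem, by simpa using ht.le⟩, map_zero _⟩
  rw [affineDim, hset, vectorSpan_eq_span_vsub_set_right ℝ h0]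
  have himg : ∀ s : Set (Fin n → ℝ), (fun x => x -ᵥ (0 : Fin n → ℝ)) '' s = s := fun s => by simp
  rw [himg, Submodule.span_image]
  exact (Submodule.equivMapOfInjective _ (linearCombination_injective hli) _).finrank_eq.symm

/-- At radius `‖w i‖` the independent vectors `w 0, …, w i` are all available. At a smaller radius
all lattice vectors lie in the span of `w 0, …, w (i - 1)`, of dimension `i`. -/
theorem successiveMinimum_eq_norm (p : Fin n → ℝ) {v : Fin n → Fin n → ℝ}
    (hli : LinearIndependent ℝ v) {w : ℕ → Fin n → ℝ} (hw : IsMinimalSeq (relLattice v) w n)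
    {i : ℕ} (hi : i < n) :
    successiveMinimum ((p +ᵥ parallelepiped v) - (p +ᵥ parallelepiped v)) (i + 1) = ‖w i‖ := by
  refine IsLeast.csInf_eq ⟨⟨hw.norm_pos hi, ?_⟩, ?_⟩
  · rw [affineDim_eq_finrank_span p hli (hw.norm_pos hi)]
    rw [← finrank_span_image_Iio (w := w) (k := i + 1) fun j hj => hw.notMem_span j (by omega)]
    refine Submodule.finrank_mono (Submodule.span_mono ?_)
    rintro _ ⟨j, hj, rfl⟩
    have hj' : j ≤ i := Nat.lt_succ_iff.1 hj
    exact ⟨hw.mem j (by omega), hw.norm_mono hj' hi⟩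
  · rintro t ⟨ht, hdim⟩
    rw [affineDim_eq_finrank_span p hli ht] at hdim
    by_contra! hlt
    have hle : Submodule.span ℝ {a | a ∈ relLattice v ∧ ‖a‖ ≤ t} ≤
        Submodule.span ℝ (w '' Set.Iio i) :=
      Submodule.span_le.2 fun a ha => hw.mem_span_of_norm_lt hi ha.1 (ha.2.trans_lt hlt)
    have := Submodule.finrank_mono hle
    rw [finrank_span_image_Iio fun j hj => hw.notMem_span j (hj.trans hi)] at this
    omega

theorem invMinima_eq (p : Fin n → ℝ) {v : Fin n → Fin n → ℝ}
    (hli : LinearIndependent ℝ v) {w : ℕ → Fin n → ℝ} (hw : IsMinimalSeq (relLattice v) w n) :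
    invMinima (p +ᵥ parallelepiped v) = fun j : Fin n => 1 / ‖w j‖ := by
  funext j
  rw [invMinima, successiveMinimum_eq_norm p hli hw j.2]

theorem IsEhrhartCoeffs.ehrhartCoeff {P : Set (Fin n → ℝ)} {g : Fin (n + 1) → ℝ}
    (h : IsEhrhartCoeffs P g) : IsEhrhartCoeffs P (EhrhartMinima.ehrhartCoeff P) :=
  Classical.epsilon_spec ⟨g, h⟩

theorem IsEhrhartCoeffs.latticePoints_eq {P : Set (Fin n → ℝ)} {g : Fin (n + 1) → ℝ}
    (h : IsEhrhartCoeffs P g) : (latticePoints P : ℝ) = ∑ i, g i := by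
  simpa using h 1

theorem sum_sigma (x : Fin n → ℝ) : ∑ i : Fin (n + 1), sigma i x = ∏ j, (x j + 1) := by
  rw [Finset.prod_add_one, Finset.sum_powerset, Finset.card_univ, Fintype.card_fin,
    Finset.sum_range]
  rfl

/-! ### The unit cube -/

theorem Icc_eq_parallelepiped :
    Set.Icc (0 : Fin n → ℝ) 1 = (0 : Fin n → ℝ) +ᵥ parallelepiped fun i => Pi.single i (1 : ℝ) := by
  rw [zero_vadd]
  refine Eq.trans ?_ (parallelepiped_single (1 : Fin n → ℝ)).symm
  rw [Set.uIcc_of_le zero_le_one]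

theorem linearIndependent_single :
    LinearIndependent ℝ fun i : Fin n => (Pi.single i 1 : Fin n → ℝ) := by
  convert (Pi.basisFun ℝ (Fin n)).linearIndependent using 1
  ext i j
  simp

theorem single_mem_integerLattice (i : Fin n) :
    (Pi.single i 1 : Fin n → ℝ) ∈ integerLattice n := by
  refine ⟨Pi.single i 1, ?_⟩
  ext j
  by_cases hj : j = i
  · subst hj; simp
  · simp [hj]

theorem mem_relLattice_single {a : Fin n → ℝ} :
    a ∈ relLattice (fun i : Fin n => (Pi.single i 1 : Fin n → ℝ)) ↔ a ∈ integerLattice n := by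
  rw [mem_relLattice]
  have : Fintype.linearCombination ℝ (fun i : Fin n => (Pi.single i 1 : Fin n → ℝ)) a = a := by
    rw [Fintype.linearCombination_apply]
    exact (pi_eq_sum_univ' a).symm
  rw [this]

theorem ncard_supportedPoints_single (J : Finset (Fin n)) :
    (supportedPoints (relLattice fun i : Fin n => (Pi.single i 1 : Fin n → ℝ)) J).ncard = 1 := by
  rw [Set.ncard_eq_one]
  refine ⟨0, Set.eq_singleton_iff_unique_mem.2 ⟨⟨⟨AddSubgroup.zero_mem _, by simp⟩, by simp⟩, ?_⟩⟩
  rintro x ⟨⟨hx, hx'⟩, -⟩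
  obtain ⟨z, rfl⟩ := mem_relLattice_single.1 hx
  funext i
  have h : (z i : ℝ) ∈ Set.Ico (0 : ℝ) 1 := hx' i
  have h1 : 0 ≤ z i := by exact_mod_cast h.1
  have h2 : z i < 1 := by exact_mod_cast h.2
  have h3 : z i = 0 := by omega
  simp [h3]

/-- A unit vector outside the proper subspace spanned so far gives the upper bound. A nonzero
integer vector has an entry of absolute value at least 1. -/
theorem IsMinimalSeq.norm_eq_one {w : ℕ → Fin n → ℝ}
    (hw : IsMinimalSeq (relLattice fun i : Fin n => (Pi.single i 1 : Fin n → ℝ)) w n) {i : ℕ}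
    (hi : i < n) : ‖w i‖ = 1 := by
  refine le_antisymm ?_ ?_
  · have hV : Submodule.span ℝ (w '' Set.Iio i) ≠ ⊤ := fun h => by
      have := finrank_span_image_Iio fun j hj => hw.notMem_span j (hj.trans hi)
      rw [h, finrank_top, Module.finrank_fin_fun] at this
      omega
    obtain ⟨j, hj⟩ := IsFractionalLattice.exists_single_notMem hV
    refine (hw.norm_le i hi _ (mem_relLattice_single.2 (single_mem_integerLattice j)) hj).trans ?_
    rw [pi_norm_le_iff_of_nonneg zero_le_one]
    intro l
    by_cases hl : l = j
    · subst hl; simp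
    · simp [hl]
  · obtain ⟨z, hz⟩ := mem_relLattice_single.1 (hw.mem i hi)
    obtain ⟨l, hl⟩ := Function.ne_iff.1 (norm_pos_iff.1 (hw.norm_pos hi))
    rw [← hz] at hl ⊢
    have hzl : z l ≠ 0 := fun h => hl (by simp [h])
    refine le_trans ?_ (norm_le_pi_norm _ l)
    change (1 : ℝ) ≤ |(z l : ℝ)|
    exact_mod_cast Int.one_le_abs hzl

end parallelepiped

end EhrhartMinima

/-! ### The main theorem -/

open EhrhartMinima in
theorem mainTheorem1 (n : ℕ) :
    (∀ Z : Set (Fin n → ℝ), EhrhartMinima.IsLatticeParallelepiped Z →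
      EhrhartMinima.IsEhrhartCoeffs Z (EhrhartMinima.ehrhartCoeff Z) ∧
      (∀ i : Fin (n + 1),
        EhrhartMinima.ehrhartCoeff Z i
          ≤ EhrhartMinima.sigma (i : ℕ) (EhrhartMinima.invMinima Z)) ∧
      (EhrhartMinima.latticePoints Z : ℝ)
        ≤ ∏ j : Fin n,
            (1 / EhrhartMinima.successiveMinimum (Z - Z) ((j : ℕ) + 1) + 1)) ∧
    EhrhartMinima.IsLatticeParallelepiped (Set.Icc (0 : Fin n → ℝ) 1) ∧
    (∀ i : Fin (n + 1),
      EhrhartMinima.ehrhartCoeff (Set.Icc (0 : Fin n → ℝ) 1) i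
        = EhrhartMinima.sigma (i : ℕ)
            (EhrhartMinima.invMinima (Set.Icc (0 : Fin n → ℝ) 1))) ∧
    (EhrhartMinima.latticePoints (Set.Icc (0 : Fin n → ℝ) 1) : ℝ)
      = ∏ j : Fin n,
          (1 / EhrhartMinima.successiveMinimum
            (Set.Icc (0 : Fin n → ℝ) 1 - Set.Icc (0 : Fin n → ℝ) 1) ((j : ℕ) + 1) + 1) := by
  have hprod : ∀ Z : Set (Fin n → ℝ), ∏ j : Fin n, (1 / successiveMinimum (Z - Z) ((j : ℕ) + 1) + 1)
      = ∑ i : Fin (n + 1), sigma i (invMinima Z) := fun Z => (sum_sigma (invMinima Z)).symm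
  have hseq : ∀ v : Fin n → Fin n → ℝ, (∀ j, v j ∈ integerLattice n) → LinearIndependent ℝ v →
      ∃ w, IsMinimalSeq (relLattice v) w n := fun v hv hli =>
    (isFractionalLattice_relLattice hv hli).exists_isMinimalSeq (Fintype.card_fin n).ge
  refine ⟨?_, ?_⟩
  · rintro Z ⟨p, v, hp, hv, hli, rfl⟩
    have hE := isEhrhartCoeffs_parallelepiped hp hv hli
    obtain ⟨w, hw⟩ := hseq v hv hli
    have hle : ∀ i : Fin (n + 1), ehrhartCoeff (p +ᵥ parallelepiped v) i ≤
        sigma i (invMinima (p +ᵥ parallelepiped v)) := fun i => by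
      rw [hE.ehrhartCoeff.unique hE, invMinima_eq p hli hw]
      exact (isFractionalLattice_relLattice hv hli).sum_ncard_supportedPoints_le hw i
    refine ⟨hE.ehrhartCoeff, hle, ?_⟩
    rw [hprod, hE.ehrhartCoeff.latticePoints_eq]
    exact Finset.sum_le_sum fun i _ => hle i
  · have h0 : (0 : Fin n → ℝ) ∈ integerLattice n := (integerSubgroup n).zero_mem
    have hE := isEhrhartCoeffs_parallelepiped h0 single_mem_integerLattice linearIndependent_single
    obtain ⟨w, hw⟩ := hseq _ single_mem_integerLattice linearIndependent_single
    have hinv := invMinima_eq 0 linearIndependent_single hw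
    rw [← Icc_eq_parallelepiped] at hE hinv
    have heq : ∀ i : Fin (n + 1), ehrhartCoeff (Set.Icc (0 : Fin n → ℝ) 1) i =
        sigma i (invMinima (Set.Icc (0 : Fin n → ℝ) 1)) := fun i => by
      rw [hE.ehrhartCoeff.unique hE, hinv]
      -- For the cube both sides are `n.choose i`: 0 is the only integer point of the half-open
      -- cube, and all minima equal 1.
      refine Finset.sum_congr rfl fun J _ => ?_
      rw [ncard_supportedPoints_single, Nat.cast_one]
      exact (Finset.prod_eq_one fun j _ => by rw [hw.norm_eq_one j.2, div_one]).symm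
    refine ⟨⟨0, _, h0, single_mem_integerLattice, linearIndependent_single,
      Icc_eq_parallelepiped⟩, heq, ?_⟩
    rw [hprod, hE.ehrhartCoeff.latticePoints_eq]
    exact Finset.sum_congr rfl fun i _ => heq i
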